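/- For real $q,t$ with $|q|<1$, $|t|<1$ let $$E_q(t)=\sum_{k=0}^{\infty}\frac{t^k}{\prod_{n=1}^{k}(1-q^n)} .$$ There exist an effective (i.e. computable from $d$ and $v$) positive constant $C_2=C_2(d,v)$ and positive real numbers $\varepsilon_2=\varepsilon_2(d,v,N)$, defined for all integers $d$ with $|d|\ge 2$, all positive integers $v$ and all integers $N$ with $|N|\ge 82836$, such that for all fixed $d,v$ we have $\varepsilon_2(d,v,N)\to 0$ as $|N|\to\infty$, and the following holds. Let $q=1/d$, where $d\in\mathbb{Z}$, $|d|\ge 2$, and let $t=u/v$, where $u\in\mathbb{Z}$, $v\in\mathbb{Z}_{\ge 1}$, $\gcd(u,v)=1$ and $0<|t|<1$. Then $$\left|E_q(t)-\frac{d^s}{N}\right|\ \ge\ C_2\,(2|N|)^{-\left(2+\frac{1}{3+2\sqrt 3}+\varepsilon_2\right)}$$ for all positive integers $s$ and all integers $N$ with $|N|\ge 82836$. -/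

import Mathlib

open Filter Topology

noncomputable section

/-- The `q`-exponential series
`E_q(t) = ∑_{k ≥ 0} t^k / ((1 - q)(1 - q^2) ⋯ (1 - q^k))`,
which converges for `|q| < 1`, `|t| < 1` (see `summable_qExp`). -/
def qExp (q t : ℝ) : ℝ :=
  ∑' k : ℕ, t ^ k / ∏ n ∈ Finset.Icc 1 k, (1 - q ^ n)

/-- The series defining `qExp q t` converges for `|q| < 1` and `|t| < 1`. -/
theorem summable_qExp {q t : ℝ} (hq : |q| < 1) (ht : |t| < 1) :
    Summable (fun k : ℕ => t ^ k / ∏ n ∈ Finset.Icc 1 k, (1 - q ^ n)) := by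
  rcases eq_or_ne t 0 with rfl | h0
  · refine summable_of_ne_finset_zero (s := {0}) ?_
    intro k hk
    have : k ≠ 0 := by simpa using hk
    simp [this]
  have hne : ∀ n : ℕ, 1 ≤ n → (1 - q ^ n) ≠ 0 := by
    intro n hn h
    have h1 : q ^ n = 1 := by linarith
    have h2 : |q| ^ n < 1 := pow_lt_one₀ (abs_nonneg q) hq (by omega)
    rw [← abs_pow, h1] at h2
    simp at h2
  have hprod : ∀ k : ℕ, ∏ n ∈ Finset.Icc 1 k, (1 - q ^ n) ≠ 0 := fun k =>
    Finset.prod_ne_zero_iff.mpr fun n hn => hne n (Finset.mem_Icc.mp hn).1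
  refine summable_of_ratio_test_tendsto_lt_one (l := |t|) ht
    (Eventually.of_forall fun k => div_ne_zero (pow_ne_zero k h0) (hprod k)) ?_
  have hlim : Tendsto (fun k : ℕ => ‖t / (1 - q ^ (k + 1))‖) atTop (𝓝 |t|) := by
    have h1 : Tendsto (fun k : ℕ => q ^ (k + 1)) atTop (𝓝 0) :=
      (tendsto_pow_atTop_nhds_zero_of_abs_lt_one hq).comp (tendsto_add_atTop_nat 1)
    have h2 : Tendsto (fun k : ℕ => t / (1 - q ^ (k + 1))) atTop (𝓝 (t / (1 - 0))) :=
      tendsto_const_nhds.div (tendsto_const_nhds.sub h1) (by norm_num)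
    simpa using h2.norm
  refine hlim.congr fun k => ?_
  rw [← norm_div]
  congr 1
  rw [Finset.prod_Icc_succ_top (by omega : 1 ≤ k + 1)]
  have a := hprod k
  have b := hne (k + 1) (by omega)
  field_simp
  ring

/-- A family of real constants `C d v` is *effective* (a computable function of the integer
parameters `d`, `v`) if some algorithm, given `d`, `v` and a precision `n`, outputs an integer
`a` with `|C d v - a / (n + 1)| ≤ 1 / (n + 1)`. -/
def EffectiveConstant (C : ℤ → ℕ → ℝ) : Prop :=
  ∃ f : ℤ × ℕ × ℕ → ℤ, Computable f ∧
    ∀ (d : ℤ) (v n : ℕ), |C d v - (f (d, v, n) : ℝ) / ((n : ℝ) + 1)| ≤ 1 / ((n : ℝ) + 1)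

end

/-! Put q = 1/d. Since E_q(xq) = (1 - x) E_q(x), one has E_q(t q^a) = F E_q(t) with F = (t; q)_a, so
E_q(t) can be studied at the tiny point x = t d^(-a). Multiplying the series by x^j multiplies its
k-th coefficient by (q^k; d)_j. Hence expanding (q^k d^(n+1); d)_n in these products gives a
polynomial Q of degree n such that Q E_q has no terms of order n+1, ..., 2n: an explicit diagonal
Padé approximant P/Q (`padeCoeff_eq_zero`).

With M = an - n(n+1)/2, the number v^(n+a) d^M (Q F d^s - P N) is an integer
(`exists_int_linearForm`); the numerator d^s itself pays for part of the denominator of Q F. The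
determinant of two consecutive approximants is a nonzero monomial (`pade_det_eq`), so the integer is
nonzero for n or n+1, hence at least 1 in absolute value. As the Padé remainder contributes at most
1/2, E_q(t) - d^s/N cannot be too small.

To leading order, integrality needs a² ≤ 2s + n², smallness of the remainder needs 2s ≤ 2an + n²,
and the bound obtained is |d|^(-(s + an + n²)). Both constraints are equalities for n = l, a =
(1+√3) l, s = (3/2+√3) l², and then (s + an + n²)/s = 2 + 1/(3+2√3) (`exists_pade_parameters`).
Rounding costs O(√s) in the exponent, which becomes ε₂.

Finally, either d^s/N is far from E_q(t), or |N| and |d|^s agree up to constants and s can be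
replaced by log(2|N|)/log|d|. -/

/-! ### Shifted factorials and their Newton expansion. -/

/-- The `p`-shifted factorial `(x; p)_m = ∏_{i < m} (1 - x p^i)`. -/
def qPoch {R : Type*} [CommRing R] (p x : R) (m : ℕ) : R :=
  ∏ i ∈ Finset.range m, (1 - x * p ^ i)

/-- The coefficients of `(x y; p)_m` in the Newton basis `(x; p)_j`, `j ≤ m`. -/
def newtonCoeff {R : Type*} [CommRing R] (p y : R) : ℕ → ℕ → R
  | 0, 0 => 1
  | 0, _ + 1 => 0
  | m + 1, 0 => newtonCoeff p y m 0 * (1 - y * p ^ m)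
  | m + 1, j + 1 => newtonCoeff p y m (j + 1) * (1 - y * p ^ (m - (j + 1))) +
      y * p ^ (m - j) * newtonCoeff p y m j

section Algebra

variable {R : Type*} [CommRing R]

theorem qPoch_succ (p x : R) (m : ℕ) :
    qPoch p x (m + 1) = qPoch p x m * (1 - x * p ^ m) := by
  simp [qPoch, Finset.prod_range_succ]

theorem qPoch_succ_left (p x : R) (m : ℕ) :
    qPoch p x (m + 1) = (1 - x) * qPoch p (x * p) m := by
  rw [qPoch, Finset.prod_range_succ', qPoch, mul_comm]
  congr 1
  · simp
  · refine Finset.prod_congr rfl fun i _ => ?_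
    ring

theorem newtonCoeff_eq_zero (p y : R) {m j : ℕ} (h : m < j) : newtonCoeff p y m j = 0 := by
  induction m generalizing j with
  | zero => cases j with
    | zero => omega
    | succ j => simp [newtonCoeff]
  | succ m ih => cases j with
    | zero => omega
    | succ j =>
      rw [newtonCoeff, ih (by omega), ih (by omega)]
      ring

/-- The recursion for `newtonCoeff` comes from 1 - x y p^m = (1 - y p^(m-j)) + y p^(m-j) (1 - x
p^j), applied to the j-th term. -/
theorem qPoch_mul_eq_sum (p x y : R) (m : ℕ) :
    qPoch p (x * y) m = ∑ j ∈ Finset.range (m + 1), newtonCoeff p y m j * qPoch p x j := by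
  induction m with
  | zero => simp [qPoch, newtonCoeff]
  | succ m ih =>
    have key : ∀ j ∈ Finset.range (m + 1),
        newtonCoeff p y m j * qPoch p x j * (1 - x * y * p ^ m) =
        newtonCoeff p y m j * (1 - y * p ^ (m - j)) * qPoch p x j +
        y * p ^ (m - j) * newtonCoeff p y m j * qPoch p x (j + 1) := by
      intro j hj
      have hj : j ≤ m := by simpa [Nat.lt_succ_iff] using hj
      obtain ⟨r, rfl⟩ := Nat.exists_eq_add_of_le hj
      rw [qPoch_succ, Nat.add_sub_cancel_left, pow_add]
      ring
    rw [qPoch_succ, ih, Finset.sum_mul, Finset.sum_congr rfl key, Finset.sum_add_distrib,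
      Finset.sum_range_succ' (fun j => newtonCoeff p y (m + 1) j * qPoch p x j)]
    have h1 : ∀ j ∈ Finset.range (m + 1),
        newtonCoeff p y (m + 1) (j + 1) * qPoch p x (j + 1) =
        newtonCoeff p y m (j + 1) * (1 - y * p ^ (m - (j + 1))) * qPoch p x (j + 1) +
        y * p ^ (m - j) * newtonCoeff p y m j * qPoch p x (j + 1) := by
      intro j _
      rw [newtonCoeff]
      ring
    rw [Finset.sum_congr rfl h1, Finset.sum_add_distrib,
      Finset.sum_range_succ' (fun j => newtonCoeff p y m j * (1 - y * p ^ (m - j)) * qPoch p x j),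
      Finset.sum_range_succ
        (fun j => newtonCoeff p y m (j + 1) * (1 - y * p ^ (m - (j + 1))) * qPoch p x (j + 1)),
      newtonCoeff_eq_zero p y (Nat.lt_succ_self m), newtonCoeff, Nat.sub_zero]
    ring

/-- With y = d^(n+1) this cancels part of the denominator of (t d^(-a))^j. -/
theorem pow_dvd_newtonCoeff (p y : R) (m j : ℕ) : y ^ j ∣ newtonCoeff p y m j := by
  induction m generalizing j with
  | zero => cases j with
    | zero => simp
    | succ j => simp [newtonCoeff]
  | succ m ih => cases j with
    | zero => simp
    | succ j =>
      rw [newtonCoeff]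
      refine dvd_add (Dvd.dvd.mul_right (ih _) _) ?_
      rw [pow_succ', mul_assoc]
      exact mul_dvd_mul_left y (Dvd.dvd.mul_left (ih j) _)

theorem newtonCoeff_zero_right (p y : R) (m : ℕ) : newtonCoeff p y m 0 = qPoch p y m := by
  induction m with
  | zero => simp [newtonCoeff, qPoch]
  | succ m ih => rw [newtonCoeff, ih, qPoch_succ]

theorem cast_newtonCoeff (p y : ℤ) (m j : ℕ) :
    ((newtonCoeff p y m j : ℤ) : R) = newtonCoeff (p : R) (y : R) m j := by
  induction m generalizing j with
  | zero => cases j <;> simp [newtonCoeff]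
  | succ m ih => cases j <;> simp [newtonCoeff, ih]

theorem cast_qPoch (p x : ℤ) (m : ℕ) :
    ((qPoch p x m : ℤ) : R) = qPoch (p : R) (x : R) m := by
  simp [qPoch]

/-- Integrality of the Gaussian binomial coefficients. -/
theorem qPoch_dvd_qPoch (p : R) (r m : ℕ) : qPoch p p m ∣ qPoch p (p ^ (r + 1)) m := by
  induction r generalizing m with
  | zero => simp
  | succ r ihr =>
    induction m with
    | zero => simp [qPoch]
    | succ m ihm =>
      -- The q-Pascal rule, multiplied through by the denominators.
      have h : qPoch p (p ^ (r + 1 + 1)) (m + 1) = qPoch p (p ^ (r + 1)) (m + 1) +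
          p ^ (r + 1) * (qPoch p (p ^ (r + 1 + 1)) m * (1 - p * p ^ m)) := by
        rw [qPoch_succ, qPoch_succ_left p (p ^ (r + 1)), ← pow_succ]
        ring
      rw [h]
      refine dvd_add (ihr _) (Dvd.dvd.mul_left ?_ _)
      rw [qPoch_succ]
      exact mul_dvd_mul_right ihm _

theorem qPoch_dvd_of_le (p x : R) {k m : ℕ} (h : k ≤ m) : qPoch p x k ∣ qPoch p x m :=
  Finset.prod_dvd_prod_of_subset _ _ _ (Finset.range_mono h)

end Algebra

theorem abs_newtonCoeff_le {p y : ℝ} (hp : 1 ≤ |p|) (hy : 1 ≤ |y|) (m j : ℕ) :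
    |newtonCoeff p y m j| ≤ 3 ^ m * |y| ^ m * |p| ^ m.choose 2 := by
  induction m generalizing j with
  | zero => cases j <;> simp [newtonCoeff]
  | succ m ih =>
    set B := 3 ^ m * |y| ^ m * |p| ^ m.choose 2 with hB
    have hB0 : 0 ≤ B := by positivity
    have hp0 : ∀ i ≤ m, |p| ^ i ≤ |p| ^ m := fun i hi => pow_le_pow_right₀ hp hi
    have h1 : ∀ i ≤ m, |1 - y * p ^ i| ≤ 1 + |y| * |p| ^ m := by
      intro i hi
      calc |1 - y * p ^ i| ≤ |1| + |y * p ^ i| := abs_sub _ _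
        _ = 1 + |y| * |p| ^ i := by simp [abs_mul, abs_pow]
        _ ≤ _ := by gcongr
    have h2 : (1 : ℝ) ≤ |y| * |p| ^ m := one_le_mul_of_one_le_of_one_le hy (one_le_pow₀ hp)
    have hS : 3 ^ (m + 1) * |y| ^ (m + 1) * |p| ^ (m + 1).choose 2 = B * (3 * (|y| * |p| ^ m)) := by
      rw [hB, Nat.choose_succ_succ' m 1, Nat.choose_one_right, pow_add]
      ring
    rw [hS]
    cases j with
    | zero =>
      rw [newtonCoeff, abs_mul]
      exact mul_le_mul (ih 0) ((h1 m le_rfl).trans (by linarith)) (abs_nonneg _) hB0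
    | succ j =>
      rw [newtonCoeff]
      calc _ ≤ |newtonCoeff p y m (j + 1) * (1 - y * p ^ (m - (j + 1)))| +
            |y * p ^ (m - j) * newtonCoeff p y m j| := abs_add_le _ _
        _ ≤ B * (1 + |y| * |p| ^ m) + (|y| * |p| ^ m) * B := by
          rw [abs_mul, abs_mul, abs_mul, abs_pow]
          exact add_le_add (mul_le_mul (ih _) (h1 _ (by omega)) (abs_nonneg _) hB0)
            (mul_le_mul (mul_le_mul_of_nonneg_left (hp0 _ (by omega)) (abs_nonneg _)) (ih _)
              (abs_nonneg _) (by positivity))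
        _ ≤ _ := by nlinarith

/-! ### The q-exponential series and its functional equation. -/

/-- The Taylor coefficients of the `q`-exponential series. -/
noncomputable def qExpCoeff (q : ℝ) (k : ℕ) : ℝ := (∏ n ∈ Finset.Icc 1 k, (1 - q ^ n))⁻¹

theorem half_le_abs_one_sub_pow {q : ℝ} (hq : |q| ≤ 1 / 2) {n : ℕ} (hn : 1 ≤ n) :
    1 / 2 ≤ |1 - q ^ n| := by
  have h1 : |q ^ n| ≤ 1 / 2 := by
    rw [abs_pow]
    calc |q| ^ n ≤ |q| ^ 1 := pow_le_pow_of_le_one (abs_nonneg q) (by linarith) hn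
      _ ≤ 1 / 2 := by simpa using hq
  have h2 := abs_sub_abs_le_abs_sub 1 (q ^ n)
  rw [abs_one] at h2
  linarith

theorem qExpCoeff_zero (q : ℝ) : qExpCoeff q 0 = 1 := by simp [qExpCoeff]

theorem qExpCoeff_succ_mul {q : ℝ} (hq : |q| ≤ 1 / 2) (k : ℕ) :
    qExpCoeff q (k + 1) * (1 - q ^ (k + 1)) = qExpCoeff q k := by
  have h := half_le_abs_one_sub_pow hq (n := k + 1) (by omega)
  have h0 : 1 - q ^ (k + 1) ≠ 0 := by
    intro h0
    rw [h0] at h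
    norm_num at h
  rw [qExpCoeff, qExpCoeff, Finset.prod_Icc_succ_top (by omega), mul_inv, mul_assoc,
    inv_mul_cancel₀ h0, mul_one]

theorem qExpCoeff_ne_zero {q : ℝ} (hq : |q| ≤ 1 / 2) (k : ℕ) : qExpCoeff q k ≠ 0 := by
  induction k with
  | zero => simp [qExpCoeff]
  | succ k ih =>
    intro h
    rw [← qExpCoeff_succ_mul hq, h, zero_mul] at ih
    exact ih rfl

theorem abs_qExpCoeff_le {q : ℝ} (hq : |q| ≤ 1 / 2) (k : ℕ) : |qExpCoeff q k| ≤ 2 ^ k := by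
  induction k with
  | zero => simp [qExpCoeff]
  | succ k ih =>
    rw [← qExpCoeff_succ_mul hq, abs_mul] at ih
    have h := half_le_abs_one_sub_pow hq (n := k + 1) (by omega)
    have h0 := abs_nonneg (qExpCoeff q (k + 1))
    rw [pow_succ]
    nlinarith

theorem hasSum_qExp {q x : ℝ} (hq : |q| ≤ 1 / 2) (hx : |x| < 1) :
    HasSum (fun k : ℕ => x ^ k * qExpCoeff q k) (qExp q x) := by
  have h := (summable_qExp (hq.trans_lt (by norm_num)) hx).hasSum
  simpa only [qExp, qExpCoeff, div_eq_mul_inv] using h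

theorem qExp_mul_left {q x : ℝ} (hq : |q| ≤ 1 / 2) (hx : |x| < 1) :
    qExp q (x * q) = (1 - x) * qExp q x := by
  have hxq : |x * q| < 1 := by
    rw [abs_mul]
    nlinarith [abs_nonneg x, abs_nonneg q]
  have h1 := hasSum_qExp hq hx
  have h2 := h1.sub (hasSum_qExp hq hxq)
  have h3 := (hasSum_nat_add_iff' 1).mpr h2
  have h4 : HasSum (fun k : ℕ => x * (x ^ k * qExpCoeff q k)) (qExp q x - qExp q (x * q)) := by
    convert h3 using 1
    · rfl
    · funext k
      rw [← qExpCoeff_succ_mul hq k]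
      ring
    · simp
  have := h4.unique (h1.mul_left x)
  linarith

theorem qExp_mul_pow {q x : ℝ} (hq : |q| ≤ 1 / 2) (hx : |x| < 1) (a : ℕ) :
    qExp q (x * q ^ a) = qPoch q x a * qExp q x := by
  induction a with
  | zero => simp [qPoch]
  | succ a ih =>
    have h : |x * q ^ a| < 1 := by
      rw [abs_mul, abs_pow]
      have := pow_le_one₀ (n := a) (abs_nonneg q) (by linarith)
      nlinarith [abs_nonneg x, pow_nonneg (abs_nonneg q) a]
    rw [pow_succ, ← mul_assoc, qExp_mul_left hq h, ih, qPoch_succ]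
    ring

theorem abs_tsum_le_geometric {f : ℕ → ℝ} {B r s : ℝ} (hs : HasSum f s) (hr0 : 0 ≤ r)
    (hr : r ≤ 1 / 2) (hB : 0 ≤ B) (hf : ∀ k, |f k| ≤ B * r ^ k) : |s| ≤ 2 * B := by
  have hg := (hasSum_geometric_of_lt_one hr0 (by linarith)).mul_left B
  have h1 : |s| ≤ B * (1 - r)⁻¹ :=
    hs.norm_le_of_bounded hg hf
  have h2 : (1 - r)⁻¹ ≤ 2 := by
    rw [inv_le_comm₀ (by linarith) (by norm_num)]
    linarith
  nlinarith

theorem abs_qExp_sub_one_le {q x : ℝ} (hq : |q| ≤ 1 / 2) (hx : |x| ≤ 1 / 8) :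
    |qExp q x - 1| ≤ 1 / 2 := by
  have h1 := (hasSum_nat_add_iff' 1).mpr (hasSum_qExp hq (hx.trans_lt (by norm_num)))
  have h2 := abs_tsum_le_geometric (B := 2 * |x|) (r := 2 * |x|) h1 (by positivity) (by linarith)
    (by positivity) (fun k => by
      rw [abs_mul, abs_pow]
      calc |x| ^ (k + 1) * |qExpCoeff q (k + 1)| ≤ |x| ^ (k + 1) * 2 ^ (k + 1) := by
            gcongr; exact abs_qExpCoeff_le hq _
        _ = _ := by ring)
  simp only [Finset.range_one, Finset.sum_singleton, pow_zero, qExpCoeff_zero, mul_one] at h2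
  linarith

/-- A shift by j replaces the coefficient c_k by c_(k-j), which is c_k times the product of 1 -
q^(k-i) over i < j; for k < j a factor vanishes. -/
theorem hasSum_pow_mul_qExp {p x : ℝ} (hp : 2 ≤ |p|) (hx : |x| < 1) (j : ℕ) :
    HasSum (fun k : ℕ => x ^ k * (qExpCoeff p⁻¹ k * qPoch p (p⁻¹ ^ k) j))
      (x ^ j * qExp p⁻¹ x) := by
  have hq : |p⁻¹| ≤ 1 / 2 := by
    rw [abs_inv, one_div]
    exact inv_anti₀ (by norm_num) hp
  have hp0 : p ≠ 0 := by
    rintro rfl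
    norm_num at hp
  induction j with
  | zero => simpa [qPoch] using hasSum_qExp hq hx
  | succ j ih =>
    refine (hasSum_nat_add_iff' 1).mp ?_
    convert ih.mul_left x using 1
    · rfl
    · funext k
      have : p⁻¹ ^ (k + 1) * p = p⁻¹ ^ k := by
        rw [pow_succ, mul_assoc, inv_mul_cancel₀ hp0, mul_one]
      rw [qPoch_succ_left, this, ← qExpCoeff_succ_mul hq k]
      ring
    · simp [qPoch_succ_left]
      ring

/-! ### Diagonal Padé approximants: vanishing coefficients and size. -/

open Polynomial in
/-- The denominator of the diagonal Padé approximant of `qExp p⁻¹`. -/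
noncomputable def padeDen (p : ℝ) (n : ℕ) : ℝ[X] :=
  ∑ j ∈ Finset.range (n + 1), C (newtonCoeff p (p ^ (n + 1)) n j) * X ^ j

/-- The Taylor coefficients of `padeDen p n * qExp p⁻¹`. -/
noncomputable def padeCoeff (p : ℝ) (n k : ℕ) : ℝ := qExpCoeff p⁻¹ k * qPoch p (p⁻¹ ^ k * p ^ (n + 1)) n

open Polynomial in
/-- The numerator of the diagonal Padé approximant of `qExp p⁻¹`. -/
noncomputable def padeNum (p : ℝ) (n : ℕ) : ℝ[X] :=
  ∑ k ∈ Finset.range (n + 1), C (padeCoeff p n k) * X ^ k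

theorem padeCoeff_eq_zero {p : ℝ} (hp : p ≠ 0) {n k : ℕ} (h1 : n < k) (h2 : k ≤ 2 * n) :
    padeCoeff p n k = 0 := by
  -- The factor with this index is 1 - p^(-k) p^(n+1) p^(k-n-1) = 0.
  rw [padeCoeff, qPoch, Finset.prod_eq_zero (i := k - (n + 1)), mul_zero]
  · simp
    omega
  · rw [mul_assoc, ← pow_add, Nat.add_sub_cancel' h1, ← mul_pow, inv_mul_cancel₀ hp]
    simp

theorem abs_qPoch_le {p x : ℝ} {m : ℕ} (h : ∀ i < m, |x * p ^ i| ≤ 1) :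
    |qPoch p x m| ≤ 2 ^ m := by
  rw [qPoch, Finset.abs_prod]
  calc _ ≤ ∏ i ∈ Finset.range m, (2 : ℝ) := by
        refine Finset.prod_le_prod (fun _ _ => abs_nonneg _) fun i hi => ?_
        have := abs_sub 1 (x * p ^ i)
        rw [abs_one] at this
        linarith [h i (Finset.mem_range.mp hi)]
    _ = 2 ^ m := by simp

theorem abs_padeCoeff_le {p : ℝ} (hp : 2 ≤ |p|) {n k : ℕ} (h : 2 * n + 1 ≤ k) :
    |padeCoeff p n k| ≤ 2 ^ k * 2 ^ n := by
  have hq : |p⁻¹| ≤ 1 / 2 := by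
    rw [abs_inv, one_div]
    exact inv_anti₀ (by norm_num) hp
  have hp0 : p ≠ 0 := by
    rintro rfl
    norm_num at hp
  rw [padeCoeff, abs_mul]
  refine mul_le_mul (abs_qExpCoeff_le hq k) (abs_qPoch_le fun i hi => ?_) (abs_nonneg _)
    (by positivity)
  obtain ⟨r, rfl⟩ : ∃ r, k = n + 1 + i + r := ⟨k - (n + 1 + i), by omega⟩
  rw [mul_assoc, ← pow_add, pow_add p⁻¹, mul_right_comm, ← mul_pow, inv_mul_cancel₀ hp0, one_pow,
    one_mul, abs_pow]
  exact pow_le_one₀ (abs_nonneg _) (by linarith)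

theorem hasSum_padeDen_mul_qExp {p x : ℝ} (hp : 2 ≤ |p|) (hx : |x| < 1) (n : ℕ) :
    HasSum (fun k : ℕ => x ^ k * padeCoeff p n k) ((padeDen p n).eval x * qExp p⁻¹ x) := by
  have h := hasSum_sum (s := Finset.range (n + 1)) fun j _ =>
    (hasSum_pow_mul_qExp hp hx j).mul_left (newtonCoeff p (p ^ (n + 1)) n j)
  convert h using 1
  · rfl
  · funext k
    rw [padeCoeff, qPoch_mul_eq_sum, Finset.mul_sum, Finset.mul_sum]
    refine Finset.sum_congr rfl fun j _ => ?_
    ring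
  · simp only [padeDen, Polynomial.eval_finsetSum, Polynomial.eval_mul, Polynomial.eval_C,
      Polynomial.eval_pow, Polynomial.eval_X, Finset.sum_mul, mul_assoc]

theorem abs_pade_remainder_le {p x : ℝ} (hp : 2 ≤ |p|) (hx : |x| ≤ 1 / 4) (n : ℕ) :
    |(padeDen p n).eval x * qExp p⁻¹ x - (padeNum p n).eval x| ≤
      2 ^ (3 * n + 2) * |x| ^ (2 * n + 1) := by
  have hp0 : p ≠ 0 := by
    rintro rfl
    norm_num at hp
  have h1 := (hasSum_nat_add_iff' (2 * n + 1)).mpr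
    (hasSum_padeDen_mul_qExp hp (hx.trans_lt (by norm_num)) n)
  have h2 : ∑ k ∈ Finset.range (2 * n + 1), x ^ k * padeCoeff p n k = (padeNum p n).eval x := by
    simp only [padeNum, Polynomial.eval_finsetSum, Polynomial.eval_mul, Polynomial.eval_C,
      Polynomial.eval_pow, Polynomial.eval_X]
    rw [← Finset.sum_subset (Finset.range_mono (by omega : n + 1 ≤ 2 * n + 1))]
    · exact Finset.sum_congr rfl fun k _ => mul_comm _ _
    · intro k hk1 hk2
      rw [Finset.mem_range] at hk1 hk2
      rw [padeCoeff_eq_zero hp0 (by omega) (by omega), mul_zero]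
  rw [h2] at h1
  have h3 := abs_tsum_le_geometric (B := 2 ^ (3 * n + 1) * |x| ^ (2 * n + 1)) (r := 2 * |x|) h1
    (by positivity) (by linarith) (by positivity) (fun k => by
      rw [abs_mul, abs_pow]
      calc _ ≤ |x| ^ (k + (2 * n + 1)) * (2 ^ (k + (2 * n + 1)) * 2 ^ n) := by
            gcongr; exact abs_padeCoeff_le hp (by omega)
        _ = _ := by ring)
  refine h3.trans (le_of_eq ?_)
  ring

/-- The coefficient bound gives |p|^(n(n+1) + n.choose 2) 3^n, and 3^n with the n+1 terms of the sum
costs at most |p|^(3n). -/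
theorem abs_eval_padeDen_le {p x : ℝ} (hp : 2 ≤ |p|) (hx : |x| ≤ 1) (n : ℕ) :
    |(padeDen p n).eval x| ≤ |p| ^ (n * n + n.choose 2 + 4 * n) := by
  simp only [padeDen, Polynomial.eval_finsetSum, Polynomial.eval_mul, Polynomial.eval_C,
    Polynomial.eval_pow, Polynomial.eval_X]
  have hb : ∀ j ∈ Finset.range (n + 1), |newtonCoeff p (p ^ (n + 1)) n j * x ^ j| ≤
      3 ^ n * |p ^ (n + 1)| ^ n * |p| ^ n.choose 2 := by
    intro j _
    rw [abs_mul, abs_pow x]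
    have hp1 : 1 ≤ |p| := by linarith
    have h1 := abs_newtonCoeff_le hp1 (y := p ^ (n + 1))
      (by rw [abs_pow]; exact one_le_pow₀ hp1) n j
    exact (mul_le_of_le_one_right (abs_nonneg _) (pow_le_one₀ (abs_nonneg _) hx)).trans h1
  have h2 : ((n : ℝ) + 1) ≤ |p| ^ n := by
    have : n + 1 ≤ 2 ^ n := n.lt_two_pow_self
    calc ((n : ℝ) + 1) ≤ 2 ^ n := by exact_mod_cast this
      _ ≤ _ := by gcongr
  have h3 : (3 : ℝ) ^ n ≤ |p| ^ (2 * n) := by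
    rw [pow_mul]
    gcongr
    nlinarith
  calc _ ≤ ∑ j ∈ Finset.range (n + 1), |newtonCoeff p (p ^ (n + 1)) n j * x ^ j| :=
        Finset.abs_sum_le_sum_abs _ _
    _ ≤ ∑ j ∈ Finset.range (n + 1), 3 ^ n * |p ^ (n + 1)| ^ n * |p| ^ n.choose 2 :=
        Finset.sum_le_sum hb
    _ = ((n : ℝ) + 1) * (3 ^ n * |p ^ (n + 1)| ^ n * |p| ^ n.choose 2) := by simp
    _ ≤ |p| ^ n * (|p| ^ (2 * n) * |p ^ (n + 1)| ^ n * |p| ^ n.choose 2) := by gcongr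
    _ = _ := by
      rw [abs_pow, ← pow_mul, ← pow_add, ← pow_add, ← pow_add]
      congr 1
      ring

/-! ### Nonvanishing: the determinant of consecutive approximants. -/

section Determinant

open Polynomial

theorem coeff_X_pow_mul_qExpCoeff {p : ℝ} (hp : 2 ≤ |p|) (j : ℕ) :
    (PowerSeries.X ^ j * PowerSeries.mk (qExpCoeff p⁻¹) : PowerSeries ℝ) =
      PowerSeries.mk fun k => qExpCoeff p⁻¹ k * qPoch p (p⁻¹ ^ k) j := by
  have hq : |p⁻¹| ≤ 1 / 2 := by
    rw [abs_inv, one_div]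
    exact inv_anti₀ (by norm_num) hp
  have hp0 : p ≠ 0 := by
    rintro rfl
    norm_num at hp
  induction j with
  | zero => simp [qPoch]
  | succ j ih =>
    rw [pow_succ', mul_assoc, ih]
    ext k
    cases k with
    | zero => simp [qPoch_succ_left]
    | succ k =>
      have : p⁻¹ ^ (k + 1) * p = p⁻¹ ^ k := by
        rw [pow_succ, mul_assoc, inv_mul_cancel₀ hp0, mul_one]
      rw [PowerSeries.coeff_succ_X_mul, PowerSeries.coeff_mk, PowerSeries.coeff_mk,
        qPoch_succ_left, this, ← qExpCoeff_succ_mul hq k]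
      ring

theorem padeDen_mul_qExpCoeff {p : ℝ} (hp : 2 ≤ |p|) (n : ℕ) :
    ((padeDen p n : ℝ[X]) : PowerSeries ℝ) * PowerSeries.mk (qExpCoeff p⁻¹) =
      PowerSeries.mk (padeCoeff p n) := by
  have : ((padeDen p n : ℝ[X]) : PowerSeries ℝ) = ∑ j ∈ Finset.range (n + 1),
      PowerSeries.C (newtonCoeff p (p ^ (n + 1)) n j) * PowerSeries.X ^ j := by
    rw [padeDen, ← Polynomial.coeToPowerSeries.ringHom_apply, map_sum]
    simp
  rw [this, Finset.sum_mul]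
  ext k
  simp only [mul_assoc, coeff_X_pow_mul_qExpCoeff hp, map_sum, PowerSeries.coeff_C_mul,
    PowerSeries.coeff_mk]
  rw [padeCoeff, qPoch_mul_eq_sum, Finset.mul_sum]
  refine Finset.sum_congr rfl fun j _ => ?_
  ring

theorem exists_pade_remainder {p : ℝ} (hp : 2 ≤ |p|) (n : ℕ) :
    ∃ r : PowerSeries ℝ, PowerSeries.coeff 0 r = padeCoeff p n (2 * n + 1) ∧
      ((padeDen p n : ℝ[X]) : PowerSeries ℝ) * PowerSeries.mk (qExpCoeff p⁻¹) =
        ((padeNum p n : ℝ[X]) : PowerSeries ℝ) + PowerSeries.X ^ (2 * n + 1) * r := by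
  have hp0 : p ≠ 0 := by
    rintro rfl
    norm_num at hp
  refine ⟨PowerSeries.mk fun k => padeCoeff p n (k + (2 * n + 1)), by simp, ?_⟩
  rw [padeDen_mul_qExpCoeff hp]
  ext k
  rw [map_add, PowerSeries.coeff_X_pow_mul', PowerSeries.coeff_mk, Polynomial.coeff_coe]
  simp only [padeNum, Polynomial.finsetSum_coeff, Polynomial.coeff_C_mul_X_pow,
    Finset.sum_ite_eq, Finset.mem_range, PowerSeries.coeff_mk]
  rcases Nat.lt_or_ge k (n + 1) with h | h
  · rw [if_pos h, if_neg (by omega), add_zero]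
  · rw [if_neg (by omega), zero_add]
    split_ifs with h2
    · rw [Nat.sub_add_cancel h2]
    · exact padeCoeff_eq_zero hp0 (by omega) (by omega)

theorem natDegree_padeDen_le (p : ℝ) (n : ℕ) : (padeDen p n).natDegree ≤ n :=
  Polynomial.natDegree_sum_le_of_forall_le _ _ fun j hj =>
    (Polynomial.natDegree_C_mul_X_pow_le _ _).trans (by simpa [Nat.lt_succ_iff] using hj)

theorem natDegree_padeNum_le (p : ℝ) (n : ℕ) : (padeNum p n).natDegree ≤ n :=
  Polynomial.natDegree_sum_le_of_forall_le _ _ fun j hj =>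
    (Polynomial.natDegree_C_mul_X_pow_le _ _).trans (by simpa [Nat.lt_succ_iff] using hj)

theorem one_sub_pow_ne_zero {p : ℝ} (hp : 2 ≤ |p|) {m : ℕ} (hm : m ≠ 0) : 1 - p ^ m ≠ 0 := by
  intro h
  have h1 : |p| ^ m = 1 := by rw [← abs_pow, ← sub_eq_zero.mp h, abs_one]
  have h2 := one_lt_pow₀ (by linarith : 1 < |p|) hm
  linarith

/-- The determinant has degree at most 2n+1, while eliminating the numerators shows that it has
order at least 2n+1. Its one coefficient is the constant term of `padeDen p (n + 1)` times the
leading remainder coefficient, both products of nonzero factors. -/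
theorem pade_det_eq {p : ℝ} (hp : 2 ≤ |p|) (n : ℕ) :
    ∃ c : ℝ, c ≠ 0 ∧ padeDen p n * padeNum p (n + 1) - padeDen p (n + 1) * padeNum p n =
      C c * X ^ (2 * n + 1) := by
  have hp0 : p ≠ 0 := by
    rintro rfl
    norm_num at hp
  have hq : |p⁻¹| ≤ 1 / 2 := by
    rw [abs_inv, one_div]
    exact inv_anti₀ (by norm_num) hp
  obtain ⟨r, hr0, hr⟩ := exists_pade_remainder hp n
  obtain ⟨r', -, hr'⟩ := exists_pade_remainder hp (n + 1)
  set W := padeDen p n * padeNum p (n + 1) - padeDen p (n + 1) * padeNum p n with hW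
  have hdeg : W.natDegree ≤ 2 * n + 1 := by
    refine (Polynomial.natDegree_sub_le _ _).trans (max_le ?_ ?_)
    · refine Polynomial.natDegree_mul_le.trans ?_
      linarith [natDegree_padeDen_le p n, natDegree_padeNum_le p (n + 1)]
    · refine Polynomial.natDegree_mul_le.trans ?_
      linarith [natDegree_padeDen_le p (n + 1), natDegree_padeNum_le p n]
  have hser : (W : PowerSeries ℝ) = PowerSeries.X ^ (2 * n + 1) *
      ((padeDen p (n + 1) : PowerSeries ℝ) * r -
        PowerSeries.X ^ 2 * (padeDen p n : PowerSeries ℝ) * r') := by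
    rw [hW, Polynomial.coe_sub, Polynomial.coe_mul, Polynomial.coe_mul]
    have e1 := eq_sub_of_add_eq hr.symm
    have e2 := eq_sub_of_add_eq hr'.symm
    rw [e1, e2]
    ring
  have hcoeff : ∀ k, W.coeff k = if 2 * n + 1 ≤ k then PowerSeries.coeff (k - (2 * n + 1))
      ((padeDen p (n + 1) : PowerSeries ℝ) * r -
        PowerSeries.X ^ 2 * (padeDen p n : PowerSeries ℝ) * r') else 0 := by
    intro k
    rw [← Polynomial.coeff_coe, hser, PowerSeries.coeff_X_pow_mul']
  refine ⟨W.coeff (2 * n + 1), ?_, ?_⟩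
  · rw [hcoeff, if_pos le_rfl, Nat.sub_self, map_sub, PowerSeries.coeff_mul, Finset.Nat.antidiagonal_zero,
      Finset.sum_singleton, hr0, mul_assoc,
      PowerSeries.coeff_X_pow_mul', if_neg (by norm_num), sub_zero, Polynomial.coeff_coe]
    refine mul_ne_zero ?_ (mul_ne_zero (qExpCoeff_ne_zero hq _) ?_)
    · simp only [padeDen, Polynomial.finsetSum_coeff, Polynomial.coeff_C_mul_X_pow,
        Finset.sum_ite_eq, Finset.mem_range]
      rw [if_pos (by omega), newtonCoeff_zero_right, qPoch, Finset.prod_ne_zero_iff]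
      intro i _
      rw [← pow_add]
      exact one_sub_pow_ne_zero hp (by omega)
    · rw [qPoch, Finset.prod_ne_zero_iff]
      intro i hi
      rw [Finset.mem_range] at hi
      obtain ⟨l, rfl⟩ : ∃ l, n = i + l + 1 := ⟨n - i - 1, by omega⟩
      have h1 : p⁻¹ ^ (2 * (i + l + 1) + 1) * p ^ (i + l + 1 + 1) * p ^ i = p⁻¹ ^ (l + 1) := by
        rw [mul_assoc, ← pow_add, show 2 * (i + l + 1) + 1 = (l + 1) + (i + l + 1 + 1 + i) by ring,
          pow_add p⁻¹, mul_assoc, ← mul_pow, inv_mul_cancel₀ hp0, one_pow, mul_one]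
      rw [h1]
      intro h0
      have := half_le_abs_one_sub_pow hq (n := l + 1) (by omega)
      rw [h0] at this
      norm_num at this
  · ext k
    rw [Polynomial.coeff_C_mul_X_pow]
    split_ifs with h
    · rw [h]
    · rcases lt_or_gt_of_ne h with h | h
      · rw [hcoeff, if_neg (by omega)]
      · exact Polynomial.coeff_eq_zero_of_natDegree_lt (by omega)

end Determinant

/-! ### Integrality of the cleared linear form. -/

section Integrality

theorem qExpCoeff_inv_mul_qPoch {p : ℝ} (hp : 2 ≤ |p|) (k : ℕ) :
    qExpCoeff p⁻¹ k * qPoch p p k = (-1) ^ k * p ^ (k + 1).choose 2 := by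
  have hq : |p⁻¹| ≤ 1 / 2 := by
    rw [abs_inv, one_div]
    exact inv_anti₀ (by norm_num) hp
  have hp0 : p ≠ 0 := by
    rintro rfl
    norm_num at hp
  induction k with
  | zero => simp [qPoch, qExpCoeff]
  | succ k ih =>
    have h1 : 1 - p * p ^ k = -p ^ (k + 1) * (1 - p⁻¹ ^ (k + 1)) := by
      rw [mul_sub, neg_mul, neg_mul, ← mul_pow, mul_inv_cancel₀ hp0]
      ring
    calc qExpCoeff p⁻¹ (k + 1) * qPoch p p (k + 1)
        = -p ^ (k + 1) * ((qExpCoeff p⁻¹ (k + 1) * (1 - p⁻¹ ^ (k + 1))) * qPoch p p k) := by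
          rw [qPoch_succ, h1]
          ring
      _ = _ := by
        rw [qExpCoeff_succ_mul hq, ih, Nat.choose_succ_succ' (k + 1) 1, Nat.choose_one_right,
          pow_add p (k + 1)]
        ring

/-- Here (d; d)_k divides (d; d)_n, which divides (d^(n-k+1); d)_n, so the denominator of the Taylor
coefficient cancels and leaves a power of d as a bonus. -/
theorem exists_padeCoeff_eq {d : ℤ} (hd : 2 ≤ |(d : ℝ)|) {n k : ℕ} (hk : k ≤ n) :
    ∃ z : ℤ, padeCoeff d n k = (d : ℝ) ^ (k + 1).choose 2 * z := by
  have hp0 : (d : ℝ) ≠ 0 := by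
    intro h
    rw [h] at hd
    norm_num at hd
  obtain ⟨z, hz⟩ := (qPoch_dvd_of_le d d hk).trans (qPoch_dvd_qPoch d (n - k) n)
  refine ⟨(-1) ^ k * z, ?_⟩
  have h1 : (d : ℝ)⁻¹ ^ k * (d : ℝ) ^ (n + 1) = ((d ^ (n - k + 1) : ℤ) : ℝ) := by
    rw [show n + 1 = k + (n - k + 1) by omega, pow_add, ← mul_assoc, ← mul_pow,
      inv_mul_cancel₀ hp0]
    simp
  rw [padeCoeff, h1, ← cast_qPoch, hz, Int.cast_mul, cast_qPoch, ← mul_assoc,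
    qExpCoeff_inv_mul_qPoch hd]
  push_cast
  ring

/-- The d-exponent ak - k(k+1)/2 in the denominator of the k-th term of the numerator is largest at
k = n; this dictates M. -/
theorem mul_add_choose_le {a n k : ℕ} (hk : k ≤ n) (hn : n ≤ a) :
    a * k + (n + 1).choose 2 ≤ a * n + (k + 1).choose 2 := by
  obtain ⟨r, rfl⟩ := Nat.exists_eq_add_of_le hk
  induction r with
  | zero => simp
  | succ r ih =>
    have h := ih (by omega) (by omega)
    have e1 : (k + (r + 1) + 1).choose 2 = (k + r + 1) + (k + r + 1).choose 2 := by
      rw [← add_assoc, Nat.choose_succ_succ' (k + r + 1) 1, Nat.choose_one_right]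
    rw [e1]
    nlinarith

theorem exists_int_padeNum {d u : ℤ} {v : ℕ} (hd : 2 ≤ |(d : ℝ)|) (hv : 1 ≤ v) {n a M : ℕ}
    (hna : n ≤ a) (hM : a * n = M + (n + 1).choose 2) :
    ∃ z : ℤ, (v : ℝ) ^ n * (d : ℝ) ^ M *
      (padeNum d n).eval ((u : ℝ) / v * (d : ℝ)⁻¹ ^ a) = z := by
  have hp0 : (d : ℝ) ≠ 0 := by
    intro h
    rw [h] at hd
    norm_num at hd
  have hv0 : (v : ℝ) ≠ 0 := by positivity
  have hterm : ∀ k ∈ Finset.range (n + 1), ∃ z : ℤ, (v : ℝ) ^ n * (d : ℝ) ^ M *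
      (padeCoeff d n k * ((u : ℝ) / v * (d : ℝ)⁻¹ ^ a) ^ k) = z := by
    intro k hk
    have hk : k ≤ n := by simpa [Nat.lt_succ_iff] using hk
    obtain ⟨z, hz⟩ := exists_padeCoeff_eq hd hk
    have h1 := mul_add_choose_le hk hna
    obtain ⟨r, hr⟩ := Nat.exists_eq_add_of_le (show a * k ≤ M + (k + 1).choose 2 by omega)
    obtain ⟨l, rfl⟩ := Nat.exists_eq_add_of_le hk
    refine ⟨v ^ l * u ^ k * d ^ r * z, ?_⟩
    have h2 : (d : ℝ) ^ M * (d : ℝ) ^ (k + 1).choose 2 * (d : ℝ)⁻¹ ^ (a * k) = (d : ℝ) ^ r := by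
      rw [← pow_add, hr, pow_add, mul_right_comm, ← mul_pow, mul_inv_cancel₀ hp0, one_pow, one_mul]
    have h3 : (v : ℝ) ^ (k + l) * ((u : ℝ) / v) ^ k = v ^ l * u ^ k := by
      rw [pow_add, div_pow]
      field_simp
    calc _ = ((v : ℝ) ^ (k + l) * ((u : ℝ) / v) ^ k) *
          ((d : ℝ) ^ M * (d : ℝ) ^ (k + 1).choose 2 * (d : ℝ)⁻¹ ^ (a * k)) * z := by
          rw [hz, pow_mul]
          ring
      _ = _ := by
        rw [h2, h3]
        push_cast
        ring
  choose! f hf using hterm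
  refine ⟨∑ k ∈ Finset.range (n + 1), f k, ?_⟩
  simp only [padeNum, Polynomial.eval_finsetSum, Polynomial.eval_mul, Polynomial.eval_C,
    Polynomial.eval_pow, Polynomial.eval_X, Finset.mul_sum]
  rw [Int.cast_sum]
  exact Finset.sum_congr rfl hf

theorem exists_int_qPoch_inv {d u : ℤ} {v : ℕ} (hd : (d : ℝ) ≠ 0) (hv : 1 ≤ v) (a : ℕ) :
    ∃ z : ℤ, (v : ℝ) ^ a * (d : ℝ) ^ a.choose 2 * qPoch (d : ℝ)⁻¹ ((u : ℝ) / v) a = z := by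
  have hv0 : (v : ℝ) ≠ 0 := by positivity
  induction a with
  | zero => exact ⟨1, by simp [qPoch]⟩
  | succ a ih =>
    obtain ⟨z, hz⟩ := ih
    refine ⟨z * (v * d ^ a - u), ?_⟩
    have h1 : (v : ℝ) * (d : ℝ) ^ a * (1 - (u : ℝ) / v * (d : ℝ)⁻¹ ^ a) = v * (d : ℝ) ^ a - u := by
      rw [inv_pow]
      field_simp
    push_cast
    rw [← hz, ← h1, qPoch_succ, Nat.choose_succ_succ' a 1, Nat.choose_one_right, pow_add, pow_succ]
    ring

theorem exists_int_padeDen {d u : ℤ} {v : ℕ} (hd : (d : ℝ) ≠ 0) (hv : 1 ≤ v) {n a : ℕ}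
    (hna : n + 1 ≤ a) :
    ∃ z : ℤ, (v : ℝ) ^ n * (d : ℝ) ^ ((a - (n + 1)) * n) *
      (padeDen d n).eval ((u : ℝ) / v * (d : ℝ)⁻¹ ^ a) = z := by
  have hv0 : (v : ℝ) ≠ 0 := by positivity
  obtain ⟨b, rfl⟩ := Nat.exists_eq_add_of_le hna
  rw [Nat.add_sub_cancel_left]
  have hterm : ∀ k ∈ Finset.range (n + 1), ∃ z : ℤ, (v : ℝ) ^ n * (d : ℝ) ^ (b * n) *
      (newtonCoeff (d : ℝ) ((d : ℝ) ^ (n + 1)) n k *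
        ((u : ℝ) / v * (d : ℝ)⁻¹ ^ (n + 1 + b)) ^ k) = z := by
    intro k hk
    have hk : k ≤ n := by simpa [Nat.lt_succ_iff] using hk
    obtain ⟨z, hz⟩ := pow_dvd_newtonCoeff d (d ^ (n + 1)) n k
    have hz' : newtonCoeff (d : ℝ) ((d : ℝ) ^ (n + 1)) n k = ((d : ℝ) ^ (n + 1)) ^ k * z := by
      have := congrArg (fun m : ℤ => (m : ℝ)) hz
      simp only [cast_newtonCoeff] at this
      push_cast at this
      exact this
    obtain ⟨l, hl⟩ := Nat.exists_eq_add_of_le hk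
    refine ⟨v ^ l * u ^ k * d ^ (b * l) * z, ?_⟩
    have h2 : (d : ℝ) ^ (b * n) * ((d : ℝ) ^ (n + 1)) ^ k * ((d : ℝ)⁻¹ ^ (n + 1 + b)) ^ k =
        (d : ℝ) ^ (b * l) := by
      rw [← pow_mul, ← pow_mul, ← pow_add,
        show b * n + (n + 1) * k = b * l + (n + 1 + b) * k by rw [hl]; ring, pow_add, mul_assoc,
        ← mul_pow, mul_inv_cancel₀ hd, one_pow, mul_one]
    have h3 : (v : ℝ) ^ n * ((u : ℝ) / v) ^ k = v ^ l * u ^ k := by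
      rw [hl, pow_add, div_pow]
      field_simp
    calc _ = ((v : ℝ) ^ n * ((u : ℝ) / v) ^ k) *
          ((d : ℝ) ^ (b * n) * ((d : ℝ) ^ (n + 1)) ^ k * ((d : ℝ)⁻¹ ^ (n + 1 + b)) ^ k) * z := by
          rw [hz', mul_pow]
          ring
      _ = _ := by
        rw [h2, h3]
        push_cast
        ring
  choose! f hf using hterm
  refine ⟨∑ k ∈ Finset.range (n + 1), f k, ?_⟩
  simp only [padeDen, Polynomial.eval_finsetSum, Polynomial.eval_mul, Polynomial.eval_C,
    Polynomial.eval_pow, Polynomial.eval_X, Finset.mul_sum]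
  rw [Int.cast_sum]
  exact Finset.sum_congr rfl hf

/-- The value at `d ^ s / N` of the Padé linear form, cleared of denominators, is an integer. -/
theorem exists_int_linearForm {d u N : ℤ} {v : ℕ} (hd : 2 ≤ |(d : ℝ)|) (hv : 1 ≤ v) {n a M s : ℕ}
    (hna : n + 1 ≤ a) (hM : a * n = M + (n + 1).choose 2)
    (hs : a.choose 2 + (a - (n + 1)) * n ≤ M + s) :
    ∃ z : ℤ, (v : ℝ) ^ (n + a) * (d : ℝ) ^ M *
      ((padeDen d n).eval ((u : ℝ) / v * (d : ℝ)⁻¹ ^ a) * qPoch (d : ℝ)⁻¹ ((u : ℝ) / v) a * d ^ s -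
        (padeNum d n).eval ((u : ℝ) / v * (d : ℝ)⁻¹ ^ a) * N) = z := by
  have hp0 : (d : ℝ) ≠ 0 := by
    intro h
    rw [h] at hd
    norm_num at hd
  obtain ⟨z₁, h₁⟩ := exists_int_padeNum (u := u) hd hv (by omega) hM
  obtain ⟨z₂, h₂⟩ := exists_int_padeDen (u := u) hp0 hv hna
  obtain ⟨z₃, h₃⟩ := exists_int_qPoch_inv (u := u) hp0 hv a
  obtain ⟨r, hr⟩ := Nat.exists_eq_add_of_le hs
  refine ⟨d ^ r * z₂ * z₃ - v ^ a * z₁ * N, ?_⟩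
  push_cast
  rw [← h₁, ← h₂, ← h₃, mul_sub]
  congr 1
  · have : (d : ℝ) ^ M * (d : ℝ) ^ s =
        (d : ℝ) ^ a.choose 2 * (d : ℝ) ^ ((a - (n + 1)) * n) * (d : ℝ) ^ r := by
      rw [← pow_add, hr, pow_add, pow_add]
    rw [pow_add]
    linear_combination ((v : ℝ) ^ n * (v : ℝ) ^ a *
      (padeDen d n).eval ((u : ℝ) / v * (d : ℝ)⁻¹ ^ a) * qPoch (d : ℝ)⁻¹ ((u : ℝ) / v) a) * this
  · rw [pow_add]
    ring

end Integrality

/-! ### From a nonzero integer to a lower bound. -/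

section Approximation

theorem abs_mul_inv_pow_le {p t : ℝ} (hp : 2 ≤ |p|) (ht : |t| < 1) (a : ℕ) :
    |t * p⁻¹ ^ a| ≤ (|p| ^ a)⁻¹ := by
  rw [abs_mul, abs_pow, abs_inv, inv_pow]
  exact mul_le_of_le_one_left (by positivity) ht.le

theorem natCast_le_pow_self {D : ℝ} (hD : 2 ≤ D) (v : ℕ) : (v : ℝ) ≤ D ^ v :=
  calc (v : ℝ) ≤ 2 ^ v := by exact_mod_cast v.lt_two_pow_self.le
    _ ≤ D ^ v := by gcongr

/-- A nonvanishing Padé linear form at `d ^ s / N` bounds the distance of `d ^ s / N` to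
`E_{1/d}(u / v)` from below. -/
theorem inv_pow_le_abs_sub_of_linearForm_ne_zero {d u N : ℤ} {v : ℕ} (hd : 2 ≤ |(d : ℝ)|)
    (hv : 1 ≤ v) (ht : |(u : ℝ) / v| < 1) {n a M s : ℕ} (ha : 2 ≤ a)
    (hna : n + 1 ≤ a) (hM : a * n = M + (n + 1).choose 2)
    (hs : a.choose 2 + (a - (n + 1)) * n ≤ M + s)
    (hR : v * (n + a) + M + s + 3 * n + 8 ≤ a * (2 * n + 1))
    (hN0 : N ≠ 0) (hN : |(N : ℝ)| ≤ 32 * |(d : ℝ)| ^ s)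
    (hne : (padeDen d n).eval ((u : ℝ) / v * (d : ℝ)⁻¹ ^ a) *
        qPoch (d : ℝ)⁻¹ ((u : ℝ) / v) a * d ^ s -
      (padeNum d n).eval ((u : ℝ) / v * (d : ℝ)⁻¹ ^ a) * N ≠ 0) :
    (|(d : ℝ)| ^ (v * (n + a) + M + s + (n * n + n.choose 2 + 4 * n) + a + 6))⁻¹ ≤
      |qExp (d : ℝ)⁻¹ ((u : ℝ) / v) - (d : ℝ) ^ s / N| := by
  have hp0 : (d : ℝ) ≠ 0 := by
    intro h
    rw [h] at hd
    norm_num at hd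
  have hq : |(d : ℝ)⁻¹| ≤ 1 / 2 := by
    rw [abs_inv, one_div]
    exact inv_anti₀ (by norm_num) hd
  have hNr : (N : ℝ) ≠ 0 := by exact_mod_cast hN0
  have hvr : (1 : ℝ) ≤ v := by exact_mod_cast hv
  obtain ⟨z, hz⟩ := exists_int_linearForm (u := u) (N := N) hd hv hna hM hs
  set t : ℝ := (u : ℝ) / v with ht_def
  set x : ℝ := t * (d : ℝ)⁻¹ ^ a with hx_def
  set D : ℝ := |(d : ℝ)| with hD_def
  set Q := (padeDen d n).eval x with hQ_def
  set P := (padeNum d n).eval x with hP_def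
  set F := qPoch (d : ℝ)⁻¹ t a with hF_def
  set E := qExp (d : ℝ)⁻¹ t with hE_def
  set δ := |E - (d : ℝ) ^ s / N| with hδ_def
  have hD1 : 1 ≤ D := by linarith
  have hδ0 : 0 ≤ δ := abs_nonneg _
  have hx : |x| ≤ (D ^ a)⁻¹ := abs_mul_inv_pow_le hd ht a
  have hx4 : |x| ≤ 1 / 4 := by
    refine hx.trans ?_
    rw [one_div]
    refine inv_anti₀ (by norm_num) ?_
    calc (4 : ℝ) = 2 ^ 2 := by norm_num
      _ ≤ D ^ 2 := by gcongr
      _ ≤ D ^ a := pow_le_pow_right₀ hD1 ha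
  have hrem : |Q * (F * E) - P| ≤ 2 ^ (3 * n + 2) * |x| ^ (2 * n + 1) := by
    have := abs_pade_remainder_le hd hx4 n
    rwa [hx_def, qExp_mul_pow hq ht a] at this
  have hQ : |Q| ≤ D ^ (n * n + n.choose 2 + 4 * n) := abs_eval_padeDen_le hd (by linarith) n
  have hF : |F| ≤ D ^ a := by
    refine (abs_qPoch_le fun i _ => ?_).trans (by gcongr)
    rw [abs_mul, abs_pow]
    exact mul_le_one₀ ht.le (by positivity) (pow_le_one₀ (abs_nonneg _) (by linarith))
  have hvD : (v : ℝ) ^ (n + a) ≤ D ^ (v * (n + a)) := by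
    rw [pow_mul]
    gcongr
    exact natCast_le_pow_self hd v
  have hND : |(N : ℝ)| ≤ D ^ (s + 5) := by
    refine hN.trans ?_
    have : (32 : ℝ) ≤ D ^ 5 := by
      calc (32 : ℝ) ≤ 2 ^ 5 := by norm_num
        _ ≤ D ^ 5 := by gcongr
    rw [pow_add, mul_comm]
    gcongr
  have hR2 : 2 ^ (3 * n + 2) * |x| ^ (2 * n + 1) ≤
      D ^ (3 * n + 2) * (D ^ (a * (2 * n + 1)))⁻¹ := by
    rw [pow_mul, ← inv_pow]
    gcongr
  have hz1 : (1 : ℝ) ≤ |(z : ℝ)| := by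
    have hz0 : z ≠ 0 := by
      rintro rfl
      rw [Int.cast_zero] at hz
      exact mul_ne_zero (mul_ne_zero (by positivity) (pow_ne_zero _ hp0)) hne hz
    exact_mod_cast Int.one_le_abs hz0
  -- The form splits into the Padé remainder and a multiple of the distance to be bounded.
  have hform : Q * F * (d : ℝ) ^ s - P * N =
      N * ((Q * (F * E) - P) - Q * F * (E - (d : ℝ) ^ s / N)) := by
    field_simp
    ring
  clear_value δ E F P Q x t
  obtain ⟨K, hK_def⟩ : ∃ K, K = D ^ (v * (n + a)) * D ^ M * D ^ (s + 5) := ⟨_, rfl⟩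
  have hK0 : 0 < K := by rw [hK_def]; positivity
  have hmain : 1 ≤ K * (D ^ (3 * n + 2) * (D ^ (a * (2 * n + 1)))⁻¹ +
      D ^ (n * n + n.choose 2 + 4 * n) * D ^ a * δ) := by
    calc (1 : ℝ) ≤ |(z : ℝ)| := hz1
      _ = (v : ℝ) ^ (n + a) * D ^ M * |(N : ℝ)| *
          |(Q * (F * E) - P) - Q * F * (E - (d : ℝ) ^ s / N)| := by
        rw [← hz, hform, abs_mul, abs_mul, abs_mul, abs_pow, abs_pow, abs_of_pos (by linarith)]
        ring
      _ ≤ (v : ℝ) ^ (n + a) * D ^ M * |(N : ℝ)| * (|Q * (F * E) - P| + |Q| * |F| * δ) := by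
        gcongr
        refine (abs_sub _ _).trans (le_of_eq ?_)
        rw [abs_mul, abs_mul, ← hδ_def]
      _ ≤ _ := by
        rw [hK_def]
        gcongr
        exact hrem.trans hR2
  have hsmall : K * (D ^ (3 * n + 2) * (D ^ (a * (2 * n + 1)))⁻¹) ≤ 1 / 2 := by
    rw [hK_def, ← mul_assoc, ← pow_add, ← pow_add, ← pow_add, ← div_eq_mul_inv,
      div_le_iff₀ (by positivity)]
    have h1 : D ^ (v * (n + a) + M + (s + 5) + (3 * n + 2)) * D ≤ D ^ (a * (2 * n + 1)) := by
      rw [← pow_succ]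
      exact pow_le_pow_right₀ hD1 (by omega)
    have h2 : 0 < D ^ (v * (n + a) + M + (s + 5) + (3 * n + 2)) := by positivity
    linarith [mul_le_mul_of_nonneg_left hd h2.le]
  have hbig : 1 / 2 ≤ K * (D ^ (n * n + n.choose 2 + 4 * n) * D ^ a) * δ := by
    rw [mul_add, ← mul_assoc K _ δ] at hmain
    linarith
  rw [inv_le_iff_one_le_mul₀ (by positivity)]
  have hpow : D ^ (v * (n + a) + M + s + (n * n + n.choose 2 + 4 * n) + a + 6) =
      K * (D ^ (n * n + n.choose 2 + 4 * n) * D ^ a) * D := by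
    rw [hK_def]
    ring
  rw [hpow]
  linarith [mul_le_mul_of_nonneg_left hd ((by norm_num : (0 : ℝ) ≤ 1 / 2).trans hbig)]

end Approximation

/-! ### Choice of n and a in terms of s. -/

section Parameters

theorem two_mul_choose_two (n : ℕ) : 2 * (n + 1).choose 2 = n * (n + 1) := by
  induction n with
  | zero => rfl
  | succ n ih =>
    rw [Nat.choose_succ_succ' (n + 1) 1, Nat.choose_one_right, mul_add, ih]
    ring

/-- Quadratic inequalities that make the Padé approximant of order `n` at `t d^{-a}` applicable. -/
theorem exists_clearing_exponent {v n a s : ℕ} (hna : n + 1 ≤ a) (hB : a * a ≤ 2 * s + n * n)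
    (hC : 2 * s + 2 * v * (n + a) + 5 * n + 16 ≤ 2 * a * n + n * n + 2 * a) :
    ∃ M : ℕ, a * n = M + (n + 1).choose 2 ∧ a.choose 2 + (a - (n + 1)) * n ≤ M + s ∧
      v * (n + a) + M + s + 3 * n + 8 ≤ a * (2 * n + 1) ∧
      2 * (v * (n + a) + M + s + (n * n + n.choose 2 + 4 * n) + a + 6) =
        2 * s + 2 * a * n + 2 * n * n + 2 * v * (n + a) + 6 * n + 2 * a + 12 := by
  obtain ⟨b, rfl⟩ := Nat.exists_eq_add_of_le hna
  rw [Nat.add_sub_cancel_left]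
  have h1 := two_mul_choose_two n
  have h2 : 2 * (n + 1 + b).choose 2 = (n + b) * (n + b + 1) := by
    rw [← two_mul_choose_two (n + b), show n + 1 + b = n + b + 1 by ring]
  have h3 : 2 * n.choose 2 + n = n * n := by
    cases n with
    | zero => rfl
    | succ n => rw [two_mul_choose_two]; ring
  have h4 : (n + 1).choose 2 ≤ (n + 1 + b) * n := by nlinarith
  obtain ⟨M, hM⟩ := Nat.exists_eq_add_of_le' h4
  exact ⟨M, hM, by nlinarith, by nlinarith, by nlinarith⟩

theorem remainder_inequality {w l v n a : ℝ} (hw : 0 ≤ w) (hl : 1 ≤ l) (hv : 0 ≤ v)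
    (hn1 : l + (2 * v + 10) ≤ n) (hn2 : n ≤ l + (2 * v + 11))
    (ha1 : a ≤ (1 + w) * l) (ha2 : (1 + w) * l ≤ a + 1) :
    2 * ((3 / 2 + w) * (l * l)) + 2 * v * (n + a) + 5 * n + 16 ≤ 2 * a * n + n * n + 2 * a := by
  have h0 : 0 ≤ w * l := by positivity
  have h1 : ((1 + w) * l - 1) * (l + (2 * v + 10) + 1) ≤ a * (n + 1) := by
    exact mul_le_mul (by linarith) (by linarith) (by linarith) (by linarith)
  have h2 : (l + (2 * v + 10)) * (l + (2 * v + 10)) ≤ n * n :=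
    mul_self_le_mul_self (by linarith) hn1
  have h3 : v * (n + a) ≤ v * ((l + (2 * v + 11)) + (1 + w) * l) := by gcongr
  have h4 : 0 ≤ v * l := by positivity
  have h5 : 0 ≤ w * l * v := by positivity
  linarith

theorem exponent_inequality {w l v n a r : ℝ} (hw : 0 ≤ w) (hw' : w ≤ 1.8) (hl : 0 ≤ l)
    (hv : 0 ≤ v) (hn0 : 0 ≤ n) (ha0 : 0 ≤ a) (hn : n + 1 ≤ l + (2 * v + 12))
    (ha : a ≤ (1 + w) * l) (hr : l ≤ r) :
    2 * a * (n + 1) + 2 * (n + 1) * (n + 1) + 2 * v * (n + 1 + a) + 6 * (n + 1) + 2 * a + 12 ≤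
      2 * ((2 + w) * (l * l) + 20 * (2 * v + 12) ^ 2 * (r + 1)) := by
  obtain ⟨g, hg⟩ : ∃ g : ℝ, g = 2 * v + 12 := ⟨_, rfl⟩
  rw [← hg] at hn ⊢
  have hg12 : 12 ≤ g := by linarith
  have hwl : w * l ≤ 1.8 * l := by gcongr
  have h1 : a * (n + 1) ≤ (1 + w) * l * (l + g) := by gcongr
  have h2 : (n + 1) * (n + 1) ≤ (l + g) * (l + g) := by gcongr
  have h3 : v * (n + 1 + a) ≤ g * (l + g + 3 * l) := by
    have h4 : n + 1 + a ≤ l + g + 3 * l := by linarith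
    have h5 : v ≤ g := by linarith
    gcongr
  have h6 : w * l * g ≤ 1.8 * l * g := by gcongr
  have h7 : g ^ 2 * l ≤ g ^ 2 * r := by gcongr
  have h8 : 12 * g * l ≤ g ^ 2 * l := by
    rw [sq]
    gcongr
  have h9 : 12 * g ≤ g ^ 2 := by
    rw [sq]
    gcongr
  have h10 : 12 * l ≤ g * l := by gcongr
  have h11 : 0 ≤ g ^ 2 * l := by positivity
  linarith

theorem exists_pade_parameters {v s : ℕ} (hs : 4 * (2 * v + 14) ^ 2 ≤ s) :
    ∃ n a : ℕ, n + 2 ≤ a ∧ v + 2 ≤ a ∧ a * a ≤ 2 * s + n * n ∧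
      2 * s + 2 * v * (n + a) + 5 * n + 16 ≤ 2 * a * n + n * n + 2 * a ∧
      (2 * s + 2 * a * (n + 1) + 2 * (n + 1) * (n + 1) + 2 * v * (n + 1 + a) + 6 * (n + 1) +
        2 * a + 12 : ℝ) ≤
        2 * ((2 + 1 / (3 + 2 * √3)) * s + 20 * (2 * v + 12) ^ 2 * (√s + 1)) := by
  obtain ⟨w, hw⟩ : ∃ w, w = √3 := ⟨_, rfl⟩
  have hw0 : 0 ≤ w := hw ▸ Real.sqrt_nonneg 3
  have hw2 : w * w = 3 := hw ▸ Real.mul_self_sqrt (by norm_num)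
  have hw1 : 1.7 ≤ w := by nlinarith
  have hw3 : w ≤ 1.8 := by nlinarith
  -- Scale at which both leading-order constraints become equalities.
  obtain ⟨l, hl⟩ : ∃ l, l = √(s / (3 / 2 + w)) := ⟨_, rfl⟩
  have hl0 : 0 ≤ l := hl ▸ Real.sqrt_nonneg _
  have hl2 : (3 / 2 + w) * (l * l) = s := by
    rw [hl, Real.mul_self_sqrt (by positivity)]
    field_simp
  have hsr : 4 * (2 * (v : ℝ) + 14) ^ 2 ≤ s := by exact_mod_cast hs
  have hvr : (0 : ℝ) ≤ v := Nat.cast_nonneg v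
  have hlv : 2 * (v : ℝ) + 14 ≤ l := by nlinarith
  have hls : l ≤ √s := by
    refine Real.le_sqrt_of_sq_le ?_
    nlinarith
  -- The surplus 2v + 10 over l gains a multiple of l that absorbs the linear terms of the remainder
  -- condition, including 2v(n+a).
  set n := ⌈l⌉₊ + (2 * v + 10) with hn
  set a := ⌊(1 + w) * l⌋₊ with ha
  have hn1 : l + (2 * v + 10) ≤ n := by
    rw [hn]
    push_cast
    linarith [Nat.le_ceil l]
  have hn2 : (n : ℝ) ≤ l + (2 * v + 11) := by
    rw [hn]
    push_cast
    linarith [Nat.ceil_lt_add_one hl0]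
  have ha1 : (a : ℝ) ≤ (1 + w) * l := Nat.floor_le (by positivity)
  have ha2 : (1 + w) * l ≤ a + 1 := (Nat.lt_floor_add_one _).le
  have hwl : 1.7 * l ≤ w * l := by nlinarith
  have hna : n + 2 ≤ a := by
    have : (n : ℝ) + 2 ≤ a := by nlinarith
    exact_mod_cast this
  refine ⟨n, a, hna, by omega, ?_, ?_, ?_⟩
  · have h1 : (a : ℝ) * a ≤ ((1 + w) * l) * ((1 + w) * l) := by gcongr
    have h2 : l * l ≤ (n : ℝ) * n := by
      have : l ≤ n := by linarith
      gcongr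
    have h3 : ((1 + w) * l) * ((1 + w) * l) = 2 * s + l * l := by
      rw [← hl2]
      linear_combination l * l * hw2
    have : (a : ℝ) * a ≤ 2 * s + n * n := by linarith
    exact_mod_cast this
  · have := remainder_inequality hw0 (by linarith) hvr hn1 hn2 ha1 ha2
    rw [hl2] at this
    exact_mod_cast this
  · rw [← hw]
    have hμ : (2 + 1 / (3 + 2 * w)) * (s : ℝ) = s + (2 + w) * (l * l) := by
      rw [← hl2]
      field_simp
      ring
    have := exponent_inequality hw0 hw3 hl0 hvr (Nat.cast_nonneg n) (Nat.cast_nonneg a)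
      (by linarith) ha1 hls
    rw [hμ]
    linarith

end Parameters

/-! ### Lower bounds, first in terms of s, then of N. -/

section LowerBound

theorem linearForm_ne_zero_or {p x Y N : ℝ} (hp : 2 ≤ |p|) (hx : x ≠ 0) (hN : N ≠ 0) (n : ℕ) :
    (padeDen p n).eval x * Y - (padeNum p n).eval x * N ≠ 0 ∨
      (padeDen p (n + 1)).eval x * Y - (padeNum p (n + 1)).eval x * N ≠ 0 := by
  by_contra! h
  obtain ⟨c, hc, hdet⟩ := pade_det_eq hp n
  have h1 := congrArg (Polynomial.eval x) hdet
  simp only [Polynomial.eval_sub, Polynomial.eval_mul, Polynomial.eval_C, Polynomial.eval_pow,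
    Polynomial.eval_X] at h1
  have h2 : N * (c * x ^ (2 * n + 1)) = 0 := by
    rw [← h1]
    linear_combination (padeDen p (n + 1)).eval x * h.1 - (padeDen p n).eval x * h.2
  exact mul_ne_zero hN (mul_ne_zero hc (pow_ne_zero _ hx)) h2

/-- The lower bound for large `s`, when `N` is not much larger than `d ^ s`. -/
theorem rpow_le_abs_qExp_sub {d u N : ℤ} {v s : ℕ} (hd : 2 ≤ |(d : ℝ)|) (hv : 1 ≤ v)
    (ht0 : (u : ℝ) / v ≠ 0) (ht : |(u : ℝ) / v| < 1) (hs : 4 * (2 * v + 14) ^ 2 ≤ s)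
    (hN0 : N ≠ 0) (hN : |(N : ℝ)| ≤ 32 * |(d : ℝ)| ^ s) :
    |(d : ℝ)| ^ (-((2 + 1 / (3 + 2 * √3)) * s + 20 * (2 * v + 12) ^ 2 * (√s + 1))) ≤
      |qExp (d : ℝ)⁻¹ ((u : ℝ) / v) - (d : ℝ) ^ s / N| := by
  obtain ⟨n, a, hna, hva, hB, hC, hW⟩ := exists_pade_parameters hs
  have hd0 : (d : ℝ) ≠ 0 := by
    intro h
    rw [h] at hd
    norm_num at hd
  have hNr : (N : ℝ) ≠ 0 := by exact_mod_cast hN0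
  have hD1 : 1 ≤ |(d : ℝ)| := by linarith
  have key : ∀ m : ℕ, n ≤ m → m ≤ n + 1 →
      (padeDen d m).eval ((u : ℝ) / v * (d : ℝ)⁻¹ ^ a) *
        (qPoch (d : ℝ)⁻¹ ((u : ℝ) / v) a * d ^ s) -
        (padeNum d m).eval ((u : ℝ) / v * (d : ℝ)⁻¹ ^ a) * N ≠ 0 →
      |(d : ℝ)| ^ (-((2 + 1 / (3 + 2 * √3)) * s + 20 * (2 * v + 12) ^ 2 * (√s + 1))) ≤
        |qExp (d : ℝ)⁻¹ ((u : ℝ) / v) - (d : ℝ) ^ s / N| := by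
    intro m hm1 hm2 hne
    -- Passing from n to n+1 adds 2v + 5 on the left and 2a + 2n + 1 on the right, so v + 2 ≤ a
    -- suffices.
    have hCm : 2 * s + 2 * v * (m + a) + 5 * m + 16 ≤ 2 * a * m + m * m + 2 * a := by
      rcases (by omega : m = n ∨ m = n + 1) with rfl | rfl <;> nlinarith
    obtain ⟨M, h1, h2, h3, h4⟩ := exists_clearing_exponent (v := v) (s := s)
      (show m + 1 ≤ a by omega) (by nlinarith) hCm
    rw [← mul_assoc] at hne
    refine le_trans ?_ (inv_pow_le_abs_sub_of_linearForm_ne_zero hd hv ht (by omega) (by omega)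
      h1 h2 h3 hN0 hN hne)
    set W := v * (m + a) + M + s + (m * m + m.choose 2 + 4 * m) + a + 6
    rw [← Real.rpow_natCast |(d : ℝ)| W, ← Real.rpow_neg (abs_nonneg _)]
    refine Real.rpow_le_rpow_of_exponent_le hD1 (neg_le_neg ?_)
    have h5 : 2 * W ≤ 2 * s + 2 * a * (n + 1) + 2 * (n + 1) * (n + 1) + 2 * v * (n + 1 + a) +
        6 * (n + 1) + 2 * a + 12 := by
      rw [h4]
      gcongr
    have h6 : (2 * W : ℝ) ≤ 2 * s + 2 * a * (n + 1) + 2 * (n + 1) * (n + 1) +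
        2 * v * (n + 1 + a) + 6 * (n + 1) + 2 * a + 12 := by exact_mod_cast h5
    linarith
  rcases linearForm_ne_zero_or (Y := qPoch (d : ℝ)⁻¹ ((u : ℝ) / v) a * d ^ s) hd
    (mul_ne_zero ht0 (pow_ne_zero a (inv_ne_zero hd0))) hNr n with h | h
  · exact key n le_rfl (by omega) h
  · exact key (n + 1) (by omega) le_rfl h

/-- After three steps of the functional equation the argument is at most 1/8, where the series is
within 1/2 of 1. The three factors divided out are controlled by |1 - u/v| ≥ 1/v, as u ≠ v. -/
theorem abs_qExp_bounds {d u : ℤ} {v : ℕ} (hd : 2 ≤ |(d : ℝ)|) (hv : 1 ≤ v)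
    (ht : |(u : ℝ) / v| < 1) :
    1 / 16 ≤ |qExp (d : ℝ)⁻¹ ((u : ℝ) / v)| ∧ |qExp (d : ℝ)⁻¹ ((u : ℝ) / v)| ≤ 6 * v := by
  have hvr : (1 : ℝ) ≤ v := by exact_mod_cast hv
  have hq : |(d : ℝ)⁻¹| ≤ 1 / 2 := by
    rw [abs_inv, one_div]
    exact inv_anti₀ (by norm_num) hd
  have h1v : 1 / (v : ℝ) ≤ |1 - (u : ℝ) / v| := by
    have h0 : (v : ℤ) - u ≠ 0 := by
      intro h
      have : (u : ℝ) = v := by exact_mod_cast (sub_eq_zero.mp h).symm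
      rw [this, div_self (by positivity), abs_one] at ht
      exact lt_irrefl _ ht
    have h1 : (1 : ℝ) ≤ |(v : ℝ) - u| := by exact_mod_cast Int.one_le_abs h0
    have h2 : 1 - (u : ℝ) / v = (v - u) / v := by field_simp
    rw [h2, abs_div, abs_of_pos (by linarith : (0 : ℝ) < v)]
    gcongr
  set t : ℝ := (u : ℝ) / v
  set q : ℝ := (d : ℝ)⁻¹
  have hpow : ∀ i : ℕ, |t * q ^ i| ≤ (1 / 2) ^ i := by
    intro i
    rw [abs_mul, abs_pow]
    calc |t| * |q| ^ i ≤ 1 * (1 / 2) ^ i := by gcongr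
      _ = _ := one_mul _
  have hE := abs_qExp_sub_one_le hq ((hpow 3).trans (by norm_num))
  rw [qExp_mul_pow hq ht 3] at hE
  have hup : |qPoch q t 3| ≤ 2 ^ 3 :=
    abs_qPoch_le fun i _ => (hpow i).trans (pow_le_one₀ (by norm_num) (by norm_num))
  have hhalf : ∀ i : ℕ, 1 ≤ i → 1 / 2 ≤ |1 - t * q ^ i| := by
    intro i hi
    have h1 := (hpow i).trans (pow_le_pow_of_le_one (by norm_num) (by norm_num) hi)
    have h2 := abs_sub_abs_le_abs_sub 1 (t * q ^ i)
    rw [abs_one] at h2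
    linarith
  have hlow : 1 / (4 * (v : ℝ)) ≤ |qPoch q t 3| := by
    rw [qPoch, Finset.abs_prod]
    simp only [Finset.prod_range_succ, Finset.prod_range_zero, one_mul, pow_zero, mul_one]
    calc 1 / (4 * (v : ℝ)) = 1 / v * (1 / 2) * (1 / 2) := by ring
      _ ≤ |1 - t| * |1 - t * q ^ 1| * |1 - t * q ^ 2| := by
        gcongr
        · exact hhalf 1 le_rfl
        · exact hhalf 2 (by norm_num)
  rw [abs_le] at hE
  have hE1 : 1 / 2 ≤ |qPoch q t 3| * |qExp q t| := by
    rw [← abs_mul]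
    linarith [le_abs_self (qPoch q t 3 * qExp q t)]
  have hE2 : |qPoch q t 3| * |qExp q t| ≤ 3 / 2 := by
    rw [← abs_mul, abs_le]
    constructor <;> linarith
  have h0 := abs_nonneg (qExp q t)
  constructor
  · nlinarith
  · have h3 : 1 / (4 * (v : ℝ)) * |qExp q t| ≤ 3 / 2 :=
      (mul_le_mul_of_nonneg_right hlow h0).trans hE2
    rw [div_mul_eq_mul_div, one_mul, div_le_iff₀ (by linarith)] at h3
    linarith

/-- The coefficient of the error term in the exponent of the lower bound. -/
def errorCoeff (v : ℕ) : ℕ :=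
  (3 + 20 * (2 * v + 12) ^ 2) * (4 * (2 * v + 14) ^ 2 + v + 3) + 20 * (2 * v + 12) ^ 2

/-- The lower bound in terms of `ℓ = log_{|d|} (2 |N|)`. -/
theorem rpow_logb_le_abs_qExp_sub {d u N : ℤ} {v : ℕ} (s : ℕ) (hd : 2 ≤ |(d : ℝ)|) (hv : 1 ≤ v)
    (ht0 : (u : ℝ) / v ≠ 0) (ht : |(u : ℝ) / v| < 1) (hN0 : N ≠ 0) :
    |(d : ℝ)| ^ (-((2 + 1 / (3 + 2 * √3)) * Real.logb |(d : ℝ)| (2 * |(N : ℝ)|) +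
        errorCoeff v * (√(Real.logb |(d : ℝ)| (2 * |(N : ℝ)|)) + 1))) ≤
      |qExp (d : ℝ)⁻¹ ((u : ℝ) / v) - (d : ℝ) ^ s / N| := by
  have hvr : (1 : ℝ) ≤ v := by exact_mod_cast hv
  have hd0 : (d : ℝ) ≠ 0 := by
    intro h
    rw [h] at hd
    norm_num at hd
  have hNr : (N : ℝ) ≠ 0 := by exact_mod_cast hN0
  have hN1 : (1 : ℝ) ≤ |(N : ℝ)| := by exact_mod_cast Int.one_le_abs hN0
  obtain ⟨hE1, hE2⟩ := abs_qExp_bounds hd hv ht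
  set E := qExp (d : ℝ)⁻¹ ((u : ℝ) / v)
  set D := |(d : ℝ)| with hD
  set ℓ := Real.logb D (2 * |(N : ℝ)|) with hℓ
  have hD1 : 1 < D := by linarith
  have hℓ0 : 0 ≤ ℓ := Real.logb_nonneg hD1 (by linarith)
  have hμ0 : 0 ≤ 1 / (3 + 2 * √3) := by positivity
  have hμ1 : 1 / (3 + 2 * √3) ≤ 1 := by
    rw [div_le_one (by positivity)]
    linarith [Real.sqrt_nonneg 3]
  set μ := 2 + 1 / (3 + 2 * √3)
  rcases le_or_gt (|E| / 2) |E - (d : ℝ) ^ s / N| with hfar | hnear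
  · refine le_trans ?_ ((by linarith : (1 : ℝ) / 32 ≤ |E| / 2).trans hfar)
    have h5 : (5 : ℝ) ≤ μ * ℓ + errorCoeff v * (√ℓ + 1) := by
      have h1 : 5 ≤ errorCoeff v := by
        have h := Nat.one_le_pow 2 (2 * v + 12) (by omega)
        exact (by linarith : 5 ≤ 20 * (2 * v + 12) ^ 2).trans (Nat.le_add_left _ _)
      have h2 : (5 : ℝ) ≤ errorCoeff v := by exact_mod_cast h1
      have h3 : 0 ≤ μ * ℓ := by positivity
      nlinarith [Real.sqrt_nonneg ℓ]
    calc D ^ (-(μ * ℓ + errorCoeff v * (√ℓ + 1))) ≤ D ^ (-(5 : ℝ)) :=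
          Real.rpow_le_rpow_of_exponent_le hD1.le (neg_le_neg h5)
      _ ≤ 2 ^ (-(5 : ℝ)) :=
          Real.rpow_le_rpow_of_nonpos (by norm_num) hd (by norm_num)
      _ = 1 / 32 := by
        rw [Real.rpow_neg (by norm_num), show (5 : ℝ) = ((5 : ℕ) : ℝ) by norm_num,
          Real.rpow_natCast]
        norm_num
  · have habs : |(d : ℝ) ^ s / N| = D ^ s / |(N : ℝ)| := by rw [abs_div, abs_pow]
    have hlo : |E| / 2 ≤ D ^ s / |(N : ℝ)| := by
      have := abs_sub_abs_le_abs_sub E ((d : ℝ) ^ s / N)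
      linarith
    have hhi : D ^ s / |(N : ℝ)| ≤ 9 * v := by
      have := abs_sub_abs_le_abs_sub ((d : ℝ) ^ s / N) E
      rw [abs_sub_comm] at this
      linarith
    -- Writing d^s/N as d^(s+J)/(N d^J) makes the exponent large enough for every s, so no small-s
    -- case remains and C₂ = 1 works.
    set J := 4 * (2 * v + 14) ^ 2 with hJ
    have hNJ : |((N * d ^ J : ℤ) : ℝ)| ≤ 32 * D ^ (s + J) := by
      have h1 : 1 / 32 ≤ D ^ s / |(N : ℝ)| := by linarith
      rw [le_div_iff₀ (by linarith)] at h1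
      push_cast
      rw [abs_mul, abs_pow, pow_add, ← hD, ← mul_assoc]
      gcongr
      linarith
    have hmain := rpow_le_abs_qExp_sub (s := s + J) hd hv ht0 ht (by omega)
      (mul_ne_zero hN0 (pow_ne_zero J (by exact_mod_cast hd0))) hNJ
    have hfrac : (d : ℝ) ^ (s + J) / ((N * d ^ J : ℤ) : ℝ) = (d : ℝ) ^ s / N := by
      push_cast
      rw [pow_add]
      field_simp
    rw [hfrac] at hmain
    refine le_trans (Real.rpow_le_rpow_of_exponent_le hD1.le (neg_le_neg ?_)) hmain
    have hsℓ : (s : ℝ) ≤ ℓ + (v + 3) := by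
      rw [div_le_iff₀ (by linarith)] at hhi
      have h1 : D ^ s ≤ D ^ (v + 3) * (2 * |(N : ℝ)|) := by
        refine hhi.trans ?_
        have h2 : (8 : ℝ) ≤ D ^ 3 := by
          calc (8 : ℝ) = 2 ^ 3 := by norm_num
            _ ≤ D ^ 3 := by gcongr
        have h3 : (v : ℝ) * 8 ≤ D ^ v * D ^ 3 := by
          gcongr
          exact natCast_le_pow_self hd v
        rw [pow_add]
        nlinarith
      have h2 := Real.logb_le_logb_of_le hD1 (by positivity) h1
      rw [Real.logb_mul (by positivity) (by positivity), Real.logb_pow, Real.logb_pow,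
        Real.logb_self_eq_one hD1, ← hℓ] at h2
      push_cast at h2
      linarith
    obtain ⟨L, hL⟩ : ∃ L : ℝ, L = J + v + 3 := ⟨_, rfl⟩
    have hL1 : 1 ≤ L := by
      have : (0 : ℝ) ≤ J := Nat.cast_nonneg J
      linarith
    have hsL : ((s + J : ℕ) : ℝ) ≤ ℓ + L := by
      push_cast
      linarith
    have hsqrt : √((s + J : ℕ) : ℝ) ≤ √ℓ + L := by
      refine Real.sqrt_le_iff.mpr ⟨by positivity, ?_⟩
      nlinarith [Real.mul_self_sqrt hℓ0, Real.sqrt_nonneg ℓ]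
    obtain ⟨K, hK⟩ : ∃ K : ℝ, K = 20 * (2 * v + 12) ^ 2 := ⟨_, rfl⟩
    have hK0 : 0 ≤ K := by rw [hK]; positivity
    have herr : (errorCoeff v : ℝ) = (3 + K) * L + K := by
      rw [errorCoeff, hK, hL, hJ]
      push_cast
      ring
    rw [← hK, herr]
    have h1 : μ * ((s + J : ℕ) : ℝ) ≤ μ * ℓ + 3 * L := by
      have : μ * L ≤ 3 * L := by
        gcongr
        linarith
      calc μ * ((s + J : ℕ) : ℝ) ≤ μ * (ℓ + L) := by gcongr
        _ ≤ _ := by linarith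
    have h2 : K * (√((s + J : ℕ) : ℝ) + 1) ≤ K * (√ℓ + L + 1) := by gcongr
    have h3 : 0 ≤ (3 + K) * L * √ℓ := by positivity
    nlinarith

end LowerBound

/-! ### Effectivity, the limit of ε₂ and the conclusion. -/

theorem effectiveConstant_one : EffectiveConstant fun _ _ => 1 := by
  refine ⟨fun x => ((x.2.2 + 1 : ℕ) : ℤ), ?_, fun d v n => ?_⟩
  · have h : Computable fun x : ℤ × ℕ × ℕ => x.2.2 + 1 :=
      Computable.succ.comp (Computable.snd.comp Computable.snd)
    have hcast : Primrec fun n : ℕ => (n : ℤ) :=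
      -- The standard encoding of ℤ sends a natural number n to 2n.
      Primrec.encode_iff.mp (Primrec.nat_mul.comp (Primrec.const 2) Primrec.id)
    exact hcast.to_comp.comp h
  · have : (n : ℝ) + 1 ≠ 0 := by positivity
    push_cast
    rw [div_self this]
    simp
    positivity

theorem tendsto_logb_two_mul_abs {D : ℝ} (hD : 1 < D) :
    Tendsto (fun N : ℤ => Real.logb D (2 * |(N : ℝ)|)) (comap (fun N : ℤ => |N|) atTop) atTop := by
  have h1 : Tendsto (fun N : ℤ => 2 * ((|N| : ℤ) : ℝ)) (comap (fun N : ℤ => |N|) atTop) atTop :=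
    ((tendsto_intCast_atTop_atTop (R := ℝ)).comp tendsto_comap).const_mul_atTop (by norm_num)
  simpa [Function.comp_def] using (Real.tendsto_logb_atTop hD).comp h1

/-- The bound holds with `C₂ = 1` and the explicit `ε₂ = errorCoeff v * (ℓ ^ (-1/2) + ℓ ^ (-1))`,
where `ℓ = log (2 |N|) / log |d|`. -/
theorem theorem2 :
    ∃ C₂ : ℤ → ℕ → ℝ, EffectiveConstant C₂ ∧
    ∃ ε₂ : ℤ → ℕ → ℤ → ℝ,
      ∀ (d : ℤ) (v : ℕ), 2 ≤ |d| → 1 ≤ v →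
        0 < C₂ d v ∧
        (∀ N : ℤ, 82836 ≤ |N| → 0 < ε₂ d v N) ∧
        Tendsto (ε₂ d v) (comap (fun N : ℤ => |N|) atTop) (𝓝 0) ∧
        ∀ u : ℤ, Int.gcd u v = 1 → 0 < |(u : ℝ) / (v : ℝ)| → |(u : ℝ) / (v : ℝ)| < 1 →
          ∀ (s : ℕ) (N : ℤ), 0 < s → 82836 ≤ |N| →
            C₂ d v * (2 * |(N : ℝ)|) ^ (-(2 + 1 / (3 + 2 * √3) + ε₂ d v N)) ≤
              |qExp (1 / (d : ℝ)) ((u : ℝ) / (v : ℝ)) - (d : ℝ) ^ s / (N : ℝ)| := by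
  refine ⟨fun _ _ => 1, effectiveConstant_one, fun d v N => errorCoeff v *
    ((√(Real.logb |(d : ℝ)| (2 * |(N : ℝ)|)))⁻¹ + (Real.logb |(d : ℝ)| (2 * |(N : ℝ)|))⁻¹), ?_⟩
  intro d v hd hv
  have hdr : 2 ≤ |(d : ℝ)| := by exact_mod_cast hd
  have hD1 : 1 < |(d : ℝ)| := by linarith
  have hℓ : ∀ N : ℤ, 82836 ≤ |N| → 0 < Real.logb |(d : ℝ)| (2 * |(N : ℝ)|) := by
    intro N hN
    have : (82836 : ℝ) ≤ |(N : ℝ)| := by exact_mod_cast hN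
    exact Real.logb_pos hD1 (by linarith)
  refine ⟨one_pos, fun N hN => ?_, ?_, ?_⟩
  · have h := hℓ N hN
    have h0 : 0 < errorCoeff v := by
      rw [errorCoeff]
      positivity
    positivity
  · have h := tendsto_logb_two_mul_abs hD1
    have h1 := tendsto_inv_atTop_zero.comp h
    have h2 := (tendsto_inv_atTop_zero.comp Real.tendsto_sqrt_atTop).comp h
    simpa using (h2.add h1).const_mul (errorCoeff v : ℝ)
  · intro u _ ht0 ht s N _ hN
    have hN0 : N ≠ 0 := by
      rintro rfl
      norm_num at hN
    have h0 := hℓ N hN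
    rw [one_mul, one_div (d : ℝ)]
    refine le_trans (le_of_eq ?_)
      (rpow_logb_le_abs_qExp_sub s hdr hv (abs_pos.mp ht0) ht hN0)
    have hNpos : 0 < 2 * |(N : ℝ)| := by
      have : (N : ℝ) ≠ 0 := by exact_mod_cast hN0
      positivity
    set ℓ := Real.logb |(d : ℝ)| (2 * |(N : ℝ)|) with hℓ_def
    have hrp : |(d : ℝ)| ^ ℓ = 2 * |(N : ℝ)| := Real.rpow_logb (by linarith) hD1.ne' hNpos
    rw [← hrp, ← Real.rpow_mul (abs_nonneg _)]
    congr 1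
    have hsq : ℓ * (√ℓ)⁻¹ = √ℓ := by
      rw [← div_eq_mul_inv, Real.div_sqrt]
    have hinv : ℓ * ℓ⁻¹ = 1 := mul_inv_cancel₀ h0.ne'
    linear_combination -(errorCoeff v : ℝ) * hsq - (errorCoeff v : ℝ) * hinv
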